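/- Work in the vocabulary of graphs, with one binary relation symbol $E$. For $k\in\mathbb N$ let $L^k_{\infty\omega}$ be the set of formulas built from the atomic formulas $x_i=x_j$ and $E(x_i,x_j)$ with $1\le i,j\le k$ by negation, the quantifiers $\exists x_i,\forall x_i$ $(1\le i\le k)$, and conjunctions and disjunctions of arbitrary, possibly infinite, families of such formulas, and let $L^\omega_{\infty\omega}=\bigcup_k L^k_{\infty\omega}$. Let $\varphi(P,v_1,\dots,v_r,v_{r+1},\dots,v_s)$ be a first-order formula in the vocabulary $\{E,P\}$ in which the $r$-ary predicate $P$ occurs only positively. For a directed graph $G$ and parameters $a=(a_{r+1},\dots,a_s)$ from $G$ put $P_0=\emptyset$ and $P_{i+1}=\{(v_1,\dots,v_r) : G\models\varphi(P_i,v_1,\dots,v_r,a_{r+1},\dots,a_s)\}$. A class $\mathcal F$ of finite directed graphs \emph{admits unbounded fixed points} if for some such $\varphi$ there is no $j\in\mathbb N$ such that $P_j=\bigcup_i P_i$ for all $G\in\mathcal F$ and all parameters $a$ from $G$. \textbf{Statement.} For every countable set $\mathcal L$ of $L^\omega_{\infty\omega}$-formulas about graphs there is a class $\mathcal F$, closed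 under isomorphism, of finite nonempty directed graphs without loops that admits unbounded fixed points and such that for every formula $\varphi\in\mathcal L$ there is a first-order formula $\psi$ in the vocabulary $\{E\}$ that is equivalent to $\varphi$ over $\mathcal F$: for every $G\in\mathcal F$ and every assignment of the variables in $G$, $G\models\varphi$ if and only if $G\models\psi$. -/

import Mathlib

open FirstOrder

universe u

namespace McColm

/-- A finite nonempty directed graph without loops. -/
structure FinDigraph where
  V : Type
  [fin : Finite V]
  [nonempty : Nonempty V]
  graph : Digraph V
  loopless : ∀ v, ¬ graph.Adj v v

attribute [instance] FinDigraph.fin FinDigraph.nonempty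

/-- A directed graph as a structure of the vocabulary with one binary relation symbol. -/
@[reducible]
def graphStructure {V : Type} (G : Digraph V) : Language.graph.Structure V where
  funMap f := f.elim
  RelMap | .adj => fun x => G.Adj (x 0) (x 1)

/-- `G` satisfies the first-order formula `ψ` about graphs under the assignment `v`. -/
def FOSat {V : Type} (G : Digraph V) {α : Type} (ψ : Language.graph.Formula α) (v : α → V) :
    Prop :=
  letI := graphStructure G
  ψ.Realize v

/-- A class of finite directed graphs is closed under isomorphism. -/
def IsoClosed (K : Set FinDigraph) : Prop :=
  ∀ G H : FinDigraph, G ∈ K → Nonempty (G.graph.Adj ≃r H.graph.Adj) → H ∈ K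

/-! ### Infinitary logic with finitely many variables -/

/-- The formulas of `L^k_{∞ω}` in the vocabulary of graphs: the only individual variables, free or
bound, are `x_i` for `i : Fin k`, and a variable may be quantified repeatedly. -/
inductive InfFormula (k : ℕ) : Type (u + 1)
  | equal (i j : Fin k) : InfFormula k
  | adj (i j : Fin k) : InfFormula k
  | neg (φ : InfFormula k) : InfFormula k
  | ex (i : Fin k) (φ : InfFormula k) : InfFormula k
  | all (i : Fin k) (φ : InfFormula k) : InfFormula k
  | disj {ι : Type u} (φ : ι → InfFormula k) : InfFormula k
  | conj {ι : Type u} (φ : ι → InfFormula k) : InfFormula k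

/-- Satisfaction of an infinitary formula under an assignment of all of its variables. -/
def InfFormula.Sat {V : Type} (G : Digraph V) {k : ℕ} : InfFormula.{u} k → (Fin k → V) → Prop
  | .equal i j, v => v i = v j
  | .adj i j, v => G.Adj (v i) (v j)
  | .neg φ, v => ¬ φ.Sat G v
  | .ex i φ, v => ∃ a : V, φ.Sat G (Function.update v i a)
  | .all i φ, v => ∀ a : V, φ.Sat G (Function.update v i a)
  | .disj φ, v => ∃ i, (φ i).Sat G v
  | .conj φ, v => ∀ i, (φ i).Sat G v

/-- The formulas of `L^ω_{∞ω}` in the vocabulary of graphs: each of them uses finitely many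
individual variables, that is, lies in `L^k_{∞ω}` for some `k`. -/
abbrev InfinitaryFormula : Type (u + 1) := Σ k : ℕ, InfFormula.{u} k

/-- Over the class `K`, the infinitary formula `φ` is equivalent to one first-order formula. -/
def EquivFirstOrder (K : Set FinDigraph) (φ : InfinitaryFormula.{u}) : Prop :=
  ∃ ψ : Language.graph.Formula (Fin φ.1), ∀ G ∈ K, ∀ v : Fin φ.1 → G.V,
    φ.2.Sat G.graph v ↔ FOSat G.graph ψ v

/-! ### Positive elementary inductions -/

/-- Relation symbols: the edge relation and one further `r`-ary symbol `P`. -/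
inductive IndRel (r : ℕ) : ℕ → Type
  | adj : IndRel r 2
  | P : IndRel r r

/-- The relation symbol is `P`, not the edge relation. -/
def IndRel.IsP {r n : ℕ} : IndRel r n → Prop
  | .adj => False
  | .P => True

/-- The vocabulary of graphs expanded by an `r`-ary relation symbol `P`. -/
def indLanguage (r : ℕ) : Language := ⟨fun _ => Empty, IndRel r⟩

/-- The expansion of a directed graph that interprets `P` by the given relation. -/
@[reducible]
def indStructure {V : Type} (G : Digraph V) {r : ℕ} (R : Set (Fin r → V)) :
    (indLanguage r).Structure V where
  funMap f := f.elim
  RelMap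
    | .adj => fun x => G.Adj (x 0) (x 1)
    | .P => fun x => x ∈ R

/-- All occurrences of `P` in the formula are positive (for `true`), or all of them are negative
(for `false`). -/
def Polarity {r : ℕ} {α : Type} : Bool → ∀ {n : ℕ}, (indLanguage r).BoundedFormula α n → Prop
  | _, _, .falsum => True
  | _, _, .equal _ _ => True
  | b, _, .rel R _ => IndRel.IsP R → b = true
  | b, _, .imp φ ψ => Polarity (!b) φ ∧ Polarity b ψ
  | b, _, .all φ => Polarity b φ

/-- A first-order formula `φ(P, v_1, …, v_r, a_1, …, a_p)` in which the `r`-ary predicate `P` occurs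
only positively. The variables `v` are those of the induction, the variables `a` are parameters. -/
structure PosInduction where
  r : ℕ
  p : ℕ
  formula : (indLanguage r).Formula (Fin r ⊕ Fin p)
  positive : Polarity true formula

/-- The stages `P_0 = ∅`, `P_{i+1} = {v | G ⊨ φ(P_i, v, a)}` of the induction. -/
def PosInduction.stage (φ : PosInduction) {V : Type} (G : Digraph V) (a : Fin φ.p → V) :
    ℕ → Set (Fin φ.r → V)
  | 0 => ∅
  | i + 1 => {v | letI := indStructure G (φ.stage G a i)
                  φ.formula.Realize (Sum.elim v a)}

/-- The induction closes after a number of stages that is bounded over the class `K`. -/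
def PosInduction.BoundedOn (φ : PosInduction) (K : Set FinDigraph) : Prop :=
  ∃ j : ℕ, ∀ G ∈ K, ∀ a : Fin φ.p → G.V, φ.stage G.graph a j = ⋃ i, φ.stage G.graph a i

/-- The class `K` admits unbounded fixed points: some positive elementary induction is not
bounded in `K`. -/
def AdmitsUnboundedFixedPoints (K : Set FinDigraph) : Prop :=
  ∃ φ : PosInduction, ¬ φ.BoundedOn K

end McColm

/-!
A multigraph is coded by its subdivision. Call an extension of a multigraph `A` generic for `k`
pebbles if it has `2 * k` new nodes and all its new multiplicities are at least `k`. Playing the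
`k`-pebble game shows that in all generic extensions of `A` the truth of a formula of `L^k_{∞ω}` at
a tuple depends only on the profile of the tuple over `A`, of which there are finitely many. Hence
`A` has a generic extension in which a node is added for each profile that makes the formula true,
and this profile is written into the multiplicities at that node. There, and in every further
extension with even larger multiplicities, a first-order formula can look up whether the profile of
a tuple is recorded, so that the infinitary formula becomes equivalent to a first-order one.

Let `G n` be the subdivision of the multigraph that records the formulas `0, …, n - 1` one after the
other, starting from a path with `n + 1` nodes whose consecutive nodes are joined by three edges. No
other multiplicity is `3`, so that the path stays definable and the induction which climbs it closes
only after `n + 1` stages. The `i`-th formula is equivalent to a fixed first-order formula in all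
`G n` with `i < n`, and the finitely many remaining graphs are described up to isomorphism.
-/

namespace McColm

/-! ### Queries defined by first-order formulas -/

/-- A query: a relation between the members of `α`-tuples, given uniformly on all directed
graphs. -/
abbrev Query (α : Type) : Type 1 := ∀ V : Type, Digraph V → (α → V) → Prop

/-- A single first-order formula defines the query on all directed graphs. -/
def FODefinable {α : Type} (Q : Query α) : Prop :=
  ∃ ψ : Language.graph.Formula α, ∀ (V : Type) (G : Digraph V) (v : α → V),
    Q V G v ↔ FOSat G ψ v

namespace FODefinable

variable {α β ι : Type} {Q R : Query α}

theorem congr (hQ : FODefinable Q) (h : ∀ V G v, R V G v ↔ Q V G v) : FODefinable R :=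
  let ⟨ψ, hψ⟩ := hQ
  ⟨ψ, fun V G v => (h V G v).trans (hψ V G v)⟩

theorem eq (a b : α) : FODefinable fun _ _ v => v a = v b :=
  ⟨Language.Term.equal (.var a) (.var b), fun _ G _ =>
    let _ := graphStructure G
    (Language.Formula.realize_equal (t₁ := .var a) (t₂ := .var b)).symm⟩

theorem adj (a b : α) : FODefinable fun _ G v => G.Adj (v a) (v b) :=
  ⟨Language.Relations.formula₂ Language.adj (.var a) (.var b), fun _ G v =>
    let _ := graphStructure G
    (Language.Formula.realize_rel₂ (R := Language.adj) (t₁ := .var a) (t₂ := .var b)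
      (v := v)).symm⟩

theorem not (hQ : FODefinable Q) : FODefinable fun V G v => ¬ Q V G v :=
  let ⟨ψ, hψ⟩ := hQ
  ⟨ψ.not, fun V G v => not_congr (hψ V G v)⟩

theorem imp (hQ : FODefinable Q) (hR : FODefinable R) :
    FODefinable fun V G v => Q V G v → R V G v :=
  let ⟨ψ, hψ⟩ := hQ
  let ⟨χ, hχ⟩ := hR
  ⟨ψ.imp χ, fun V G v => imp_congr (hψ V G v) (hχ V G v)⟩

theorem or (hQ : FODefinable Q) (hR : FODefinable R) :
    FODefinable fun V G v => Q V G v ∨ R V G v :=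
  (hQ.not.imp hR).congr fun _ _ _ => or_iff_not_imp_left

theorem and (hQ : FODefinable Q) (hR : FODefinable R) :
    FODefinable fun V G v => Q V G v ∧ R V G v :=
  (hQ.imp hR.not).not.congr fun _ _ _ => by tauto

theorem iff (hQ : FODefinable Q) (hR : FODefinable R) :
    FODefinable fun V G v => Q V G v ↔ R V G v :=
  ((hQ.imp hR).and (hR.imp hQ)).congr fun _ _ _ => iff_iff_implies_and_implies

theorem const (p : Prop) : FODefinable (α := α) fun _ _ _ => p := by
  by_cases hp : p
  · exact ⟨⊤, fun _ G _ =>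
      let _ := graphStructure G
      iff_of_true hp (Language.Formula.realize_top.2 trivial)⟩
  · exact ⟨⊥, fun _ _ _ => iff_of_false hp id⟩

theorem iAnd [Finite ι] {Q : ι → Query α} (hQ : ∀ i, FODefinable (Q i)) :
    FODefinable fun V G v => ∀ i, Q i V G v := by
  choose ψ hψ using hQ
  refine ⟨Language.Formula.iInf ψ, fun V G v => ?_⟩
  let _ := graphStructure G
  exact (forall_congr' fun i => hψ i V G v).trans Language.Formula.realize_iInf.symm

theorem iOr [Finite ι] {Q : ι → Query α} (hQ : ∀ i, FODefinable (Q i)) :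
    FODefinable fun V G v => ∃ i, Q i V G v :=
  (iAnd fun i => (hQ i).not).not.congr fun _ _ _ => by simp

theorem exs [Finite β] {Q : Query (α ⊕ β)} (hQ : FODefinable Q) :
    FODefinable fun V G v => ∃ w : β → V, Q V G (Sum.elim v w) := by
  obtain ⟨ψ, hψ⟩ := hQ
  refine ⟨ψ.iExs β, fun V G v => ?_⟩
  let _ := graphStructure G
  exact (exists_congr fun w => hψ V G (Sum.elim v w)).trans Language.Formula.realize_iExs.symm

theorem ex {Q : Query (α ⊕ Unit)} (hQ : FODefinable Q) :
    FODefinable fun V G v => ∃ x, Q V G (Sum.elim v fun _ => x) :=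
  hQ.exs.congr fun _ _ _ => ⟨fun ⟨x, hx⟩ => ⟨fun _ => x, hx⟩, fun ⟨w, hw⟩ => ⟨w (), hw⟩⟩

theorem all {Q : Query (α ⊕ Unit)} (hQ : FODefinable Q) :
    FODefinable fun V G v => ∀ x, Q V G (Sum.elim v fun _ => x) :=
  hQ.not.ex.not.congr fun _ _ _ => not_exists_not.symm

end FODefinable

/-! ### Invariance under isomorphism -/

/-- The query is invariant under isomorphisms of directed graphs. -/
def IsoInvariant {α : Type} (Q : Query α) : Prop :=
  ∀ ⦃V W : Type⦄ ⦃G : Digraph V⦄ ⦃H : Digraph W⦄ (e : G.Adj ≃r H.Adj) (v : α → V),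
    Q V G v ↔ Q W H (e ∘ v)

theorem InfFormula.isoInvariant_sat {k : ℕ} (φ : InfFormula.{u} k) :
    IsoInvariant fun _ G v => φ.Sat G v := by
  intro V W G H e v
  induction φ generalizing v with
  | equal i j => exact e.injective.eq_iff.symm
  | adj i j => exact e.map_rel_iff.symm
  | neg φ ih => exact not_congr (ih v)
  | ex i φ ih =>
    simp only [Sat, ih, Function.comp_update]
    exact (e.surjective.exists (p := fun a => φ.Sat H (Function.update (e ∘ v) i a))).symm
  | all i φ ih =>
    simp only [Sat, ih, Function.comp_update]
    exact (e.surjective.forall (p := fun a => φ.Sat H (Function.update (e ∘ v) i a))).symm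
  | disj φ ih => exact exists_congr fun i => ih i v
  | conj φ ih => exact forall_congr' fun i => ih i v

theorem FODefinable.isoInvariant {α : Type} {Q : Query α} (hQ : FODefinable Q) :
    IsoInvariant Q := by
  obtain ⟨ψ, hψ⟩ := hQ
  intro V W G H e v
  rw [hψ, hψ]
  let _ := graphStructure G
  let _ := graphStructure H
  let g : V ≃[Language.graph] W :=
    { e.toEquiv with
      map_fun' := fun f => f.elim
      map_rel' := fun {n} r x => by
        cases r
        exact e.map_rel_iff }
  exact (Language.StrongHomClass.realize_formula g ψ).symm

/-- The tuple `y` lists the vertices of `H` as an isomorphic copy of `G`. -/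
def IsCopy {V W : Type} (G : Digraph V) (H : Digraph W) (y : V → W) : Prop :=
  Function.Bijective y ∧ ∀ a b, H.Adj (y a) (y b) ↔ G.Adj a b

theorem exists_isCopy_and_iff {V W : Type} {G : Digraph V} {H : Digraph W} {p : (V → W) → Prop} :
    (∃ y, IsCopy G H y ∧ p y) ↔ ∃ e : G.Adj ≃r H.Adj, p e :=
  ⟨fun ⟨y, hy, hp⟩ => ⟨⟨Equiv.ofBijective y hy.1, hy.2 _ _⟩, hp⟩,
    fun ⟨e, hp⟩ => ⟨e, ⟨e.bijective, fun _ _ => e.map_rel_iff⟩, hp⟩⟩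

theorem FODefinable.isCopy {V α : Type} [Finite V] (G : Digraph V) (f : V → α) :
    FODefinable fun _ H v => IsCopy G H fun a => v (f a) :=
  .and (.and (.iAnd fun a => .iAnd fun b => .imp (.eq (f a) (f b)) (.const (a = b)))
      (.all (.iOr fun a => .eq (α := α ⊕ Unit) (.inl (f a)) (.inr ()))))
    (.iAnd fun a => .iAnd fun b => .iff (.adj (f a) (f b)) (.const (G.Adj a b)))

theorem IsoInvariant.foDefinable_of_finite {V α : Type} [Finite V] [Finite α] {Q : Query α}
    (hQ : IsoInvariant Q) (G : Digraph V) :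
    FODefinable fun W H w => Nonempty (G.Adj ≃r H.Adj) ∧ Q W H w := by
  have hcopy : FODefinable fun W (H : Digraph W) (w : α → W) => ∃ y : V → W,
      IsCopy G H y ∧ ∃ u : {u : α → V // Q V G u}, ∀ i, w i = y (u.1 i) :=
    .exs (.and (.isCopy G (Sum.inr : V → α ⊕ V)) (.iOr fun u : {u : α → V // Q V G u} =>
      .iAnd fun i => .eq (Sum.inl i) (.inr (u.1 i))))
  refine hcopy.congr fun W H w => ?_
  simp only [exists_isCopy_and_iff, ← funext_iff]
  constructor
  · rintro ⟨⟨e⟩, hw⟩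
    have hcomp : e ∘ e.symm ∘ w = w := by ext; simp
    exact ⟨e, ⟨e.symm ∘ w, (hQ e _).2 (hcomp.symm ▸ hw)⟩, hcomp.symm⟩
  · rintro ⟨e, u, rfl⟩
    exact ⟨⟨e⟩, (hQ e u).1 u.2⟩

/-- The closure of a class of finite directed graphs under isomorphism. -/
def isoClosure (K : Set FinDigraph) : Set FinDigraph :=
  {H | ∃ G ∈ K, Nonempty (G.graph.Adj ≃r H.graph.Adj)}

theorem subset_isoClosure (K : Set FinDigraph) : K ⊆ isoClosure K :=
  fun G hG => ⟨G, hG, ⟨.refl _⟩⟩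

theorem isoClosed_isoClosure (K : Set FinDigraph) : IsoClosed (isoClosure K) := by
  rintro G H ⟨F, hF, ⟨e⟩⟩ ⟨f⟩
  exact ⟨F, hF, ⟨e.trans f⟩⟩

theorem IsoInvariant.exists_formula_of_forall_gt {α : Type} [Finite α] {Q R : Query α}
    (hQ : IsoInvariant Q) (hR : FODefinable R) (G : ℕ → FinDigraph) (i : ℕ)
    (h : ∀ n, i < n → ∀ v, Q _ (G n).graph v ↔ R _ (G n).graph v) :
    ∃ ψ : Language.graph.Formula α, ∀ H ∈ isoClosure (Set.range G), ∀ v : α → H.V,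
      Q _ H.graph v ↔ FOSat H.graph ψ v := by
  have htrue : IsoInvariant (α := α) fun _ _ _ => True := fun _ _ _ _ _ _ => Iff.rfl
  obtain ⟨ψ, hψ⟩ : FODefinable fun W H w =>
      (∃ m : Fin (i + 1), Nonempty ((G m).graph.Adj ≃r H.Adj) ∧ Q W H w) ∨
        (¬ ∃ m : Fin (i + 1), Nonempty ((G m).graph.Adj ≃r H.Adj) ∧ True) ∧ R W H w :=
    .or (.iOr fun m => hQ.foDefinable_of_finite (G m).graph)
      (.and (.not (.iOr fun m => htrue.foDefinable_of_finite (G m).graph)) hR)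
  refine ⟨ψ, ?_⟩
  rintro H ⟨_, ⟨n, rfl⟩, ⟨e⟩⟩ w
  rw [← hψ]
  by_cases hsmall : ∃ m : Fin (i + 1), Nonempty ((G m).graph.Adj ≃r H.graph.Adj)
  · simp [hsmall]
  · have hn : i < n := by
      by_contra hn
      exact hsmall ⟨⟨n, by lia⟩, ⟨e⟩⟩
    have hw : e ∘ e.symm ∘ w = w := by ext; simp
    have hQR : Q _ H.graph w ↔ R _ H.graph w := by
      rw [← hw, ← hQ e, ← hR.isoInvariant e, h n hn]
    simp [hsmall, hQR]

/-! ### Extending tuples with the same equality pattern -/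

section Kernel

variable {α β κ : Type*} {z : κ → α} {z' : κ → β}

theorem ker_comp_eq_ker_comp {κ' : Type*} (h : Setoid.ker z = Setoid.ker z') (r : κ' → κ) :
    Setoid.ker (z ∘ r) = Setoid.ker (z' ∘ r) :=
  congrArg (Setoid.comap r) h

theorem ker_eq_ker_iff : Setoid.ker z = Setoid.ker z' ↔ ∀ p q, z p = z q ↔ z' p = z' q :=
  Setoid.ext_iff.trans Iff.rfl

theorem ker_optionElim_eq_ker_optionElim (h : Setoid.ker z = Setoid.ker z') {x : α} {x' : β}
    (hx : ∀ p, z p = x ↔ z' p = x') :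
    Setoid.ker (fun o : Option κ => o.elim x z) = Setoid.ker fun o : Option κ => o.elim x' z' := by
  rw [ker_eq_ker_iff] at h ⊢
  rintro (_ | p) (_ | q)
  · exact iff_of_true rfl rfl
  · exact eq_comm.trans ((hx q).trans eq_comm)
  · exact hx p
  · exact h p q

theorem exists_ker_optionElim_eq (h : Setoid.ker z = Setoid.ker z')
    (hz' : ¬ Function.Surjective z') (x : α) :
    ∃ x' : β, Setoid.ker (fun o : Option κ => o.elim x z) =
      Setoid.ker fun o : Option κ => o.elim x' z' := by
  by_cases hx : ∃ p, z p = x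
  · obtain ⟨p, rfl⟩ := hx
    exact ⟨z' p, ker_optionElim_eq_ker_optionElim h fun q => ker_eq_ker_iff.1 h q p⟩
  · obtain ⟨x', hx'⟩ := not_forall.1 hz'
    exact ⟨x', ker_optionElim_eq_ker_optionElim h fun p =>
      iff_of_false (fun hp => hx ⟨p, hp⟩) fun hp => hx' ⟨p, hp⟩⟩

theorem ker_sumElim_eq_ker_sumElim_iff {B : Type*} {f : B → α} {f' : B → β}
    (hf : Function.Injective f) (hf' : Function.Injective f') :
    Setoid.ker (Sum.elim f z) = Setoid.ker (Sum.elim f' z') ↔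
      Setoid.ker z = Setoid.ker z' ∧ ∀ a p, z p = f a ↔ z' p = f' a := by
  simp only [ker_eq_ker_iff]
  constructor
  · exact fun h => ⟨fun p q => h (.inr p) (.inr q), fun a p => h (.inr p) (.inl a)⟩
  · rintro ⟨h, hb⟩ (a | p) (b | q)
    · exact hf.eq_iff.trans hf'.eq_iff.symm
    · exact eq_comm.trans ((hb a q).trans eq_comm)
    · exact hb b p
    · exact h p q

end Kernel

/-! ### Multigraphs and their subdivisions -/

/-- A finite directed multigraph: `mult x y` is the number of parallel edges from `x` to `y`. -/
structure Multigraph where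
  X : Type
  [fin : Finite X]
  mult : X → X → ℕ

namespace Multigraph

attribute [instance] Multigraph.fin

/-- The edges of a multigraph. -/
abbrev Edge (M : Multigraph) : Type := Σ p : M.X × M.X, Fin (M.mult p.1 p.2)

/-- The points of the subdivision: the nodes and the edges of the multigraph. -/
abbrev Point (M : Multigraph) : Type := M.X ⊕ M.Edge

/-- The subdivision of a multigraph: every edge `e` from `x` to `y` is replaced by a path
`x → e → y`. -/
def subdivision (M : Multigraph) : Digraph M.Point where
  Adj
    | .inl x, .inr e => e.1.1 = x
    | .inr e, .inl y => e.1.2 = y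
    | _, _ => False

/-- The subdivision of a multigraph as a finite directed graph without loops. -/
def toFinDigraph (M : Multigraph) [Nonempty M.X] : FinDigraph where
  V := M.Point
  graph := M.subdivision
  loopless := by rintro (x | e) h <;> exact h

/-- The source (`false`) and the target (`true`) of an edge; both are `x` for a node `x`. -/
def endpoint (M : Multigraph) : M.Point → Bool → M.X
  | .inl x, _ => x
  | .inr e, false => e.1.1
  | .inr e, true => e.1.2

/-- The `c`-th edge from `x` to `y`, as a point of the subdivision. -/
def edge (M : Multigraph) (x y : M.X) (c : Fin (M.mult x y)) : M.Point := .inr ⟨(x, y), c⟩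

variable {A M M' : Multigraph}

theorem edge_injective (x y : M.X) : Function.Injective (M.edge x y) := fun c d h => by
  simpa [edge] using h

theorem eq_inl_iff {z : M.Point} {x : M.X} :
    z = .inl x ↔ z.isLeft = true ∧ M.endpoint z false = x := by
  rcases z with y | e <;> simp [endpoint]

theorem mem_range_edge_iff {z : M.Point} {x y : M.X} :
    z ∈ Set.range (M.edge x y) ↔
      z.isLeft = false ∧ M.endpoint z false = x ∧ M.endpoint z true = y := by
  constructor
  · rintro ⟨c, rfl⟩
    exact ⟨rfl, rfl, rfl⟩
  · rintro ⟨hz, rfl, rfl⟩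
    rcases z with x | ⟨⟨x, y⟩, c⟩
    · simp at hz
    · exact ⟨c, rfl⟩

theorem subdivision_adj_iff {z w : M.Point} : M.subdivision.Adj z w ↔
    z.isLeft ≠ w.isLeft ∧ M.endpoint z true = M.endpoint w false := by
  rcases z with x | e <;> rcases w with y | e' <;> simp [subdivision, endpoint, eq_comm]

/-- The node map `f` identifies `A` with a part of `M`, and every multiplicity of `M` that involves
a node outside of this part is at least `N`. -/
structure Extends (N : ℕ) (f : A.X ↪ M.X) : Prop where
  mult_eq : ∀ a b, M.mult (f a) (f b) = A.mult a b
  le_mult : ∀ x y, (x ∉ Set.range f ∨ y ∉ Set.range f) → N ≤ M.mult x y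

theorem Extends.refl (N : ℕ) (M : Multigraph) : Extends N (.refl M.X) :=
  ⟨fun _ _ => rfl, by simp⟩

theorem Extends.mem_range_of_mult_lt {N : ℕ} {f : A.X ↪ M.X} (hf : Extends N f) {x y : M.X}
    (h : M.mult x y < N) : x ∈ Set.range f ∧ y ∈ Set.range f := by
  by_contra hxy
  exact h.not_ge (hf.le_mult x y (not_and_or.1 hxy))

theorem Extends.mono {N N' : ℕ} {f : A.X ↪ M.X} (hf : Extends N' f) (hN : N ≤ N') :
    Extends N f :=
  ⟨hf.mult_eq, fun x y hxy => hN.trans (hf.le_mult x y hxy)⟩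

theorem Extends.trans {N N' : ℕ} {f : A.X ↪ M.X} {g : M.X ↪ M'.X} (hf : Extends N f)
    (hg : Extends N' g) (hN : N ≤ N') : Extends N (f.trans g) where
  mult_eq a b := (hg.mult_eq _ _).trans (hf.mult_eq a b)
  le_mult x y hxy := by
    by_contra! hlt
    obtain ⟨⟨x, rfl⟩, ⟨y, rfl⟩⟩ := hg.mem_range_of_mult_lt (hlt.trans_le hN)
    rw [hg.mult_eq] at hlt
    obtain ⟨⟨a, rfl⟩, ⟨b, rfl⟩⟩ := hf.mem_range_of_mult_lt hlt
    exact hxy.elim (fun h => h ⟨a, rfl⟩) fun h => h ⟨b, rfl⟩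

/-- An extension in which `k` pebbles cannot exhaust what is new: outside of `A` there are `2 * k`
nodes, enough for both endpoints of every pebble, and at least `k` edges between any two nodes that
do not both belong to `A`. -/
structure IsGeneric (k : ℕ) (f : A.X ↪ M.X) : Prop extends Extends k f where
  card_le : Nat.card A.X + 2 * k ≤ Nat.card M.X

theorem IsGeneric.trans {k N : ℕ} {f : A.X ↪ M.X} {g : M.X ↪ M'.X} (hf : IsGeneric k f)
    (hg : Extends N g) (hN : k ≤ N) : IsGeneric k (f.trans g) where
  toExtends := hf.toExtends.trans hg hN
  card_le := hf.card_le.trans (Nat.card_le_card_of_injective g g.injective)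

/-! ### The pebble game on two extensions -/

section Game

variable {k : ℕ} {ι : Type} {f : A.X ↪ M.X} {f' : A.X ↪ M'.X}
  {v : ι → M.Point} {v' : ι → M'.Point}

/-- The nodes that matter for a tuple `v` of points of an extension of `A`: the nodes of `A` and the
endpoints of `v`. -/
def nodes (f : A.X ↪ M.X) (v : ι → M.Point) : A.X ⊕ (ι × Bool) → M.X :=
  Sum.elim f fun σ => M.endpoint (v σ.1) σ.2

/-- Positions of the pebble game on two extensions of `A` that the duplicator maintains. -/
structure Similar (f : A.X ↪ M.X) (f' : A.X ↪ M'.X) (v : ι → M.Point) (v' : ι → M'.Point) :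
    Prop where
  ker_eq : Setoid.ker v = Setoid.ker v'
  isLeft_eq : ∀ p, (v p).isLeft = (v' p).isLeft
  ker_nodes_eq : Setoid.ker (nodes f v) = Setoid.ker (nodes f' v')

namespace Similar

theorem symm (h : Similar f f' v v') : Similar f' f v' v :=
  ⟨h.ker_eq.symm, fun p => (h.isLeft_eq p).symm, h.ker_nodes_eq.symm⟩

theorem comp {ι' : Type} (h : Similar f f' v v') (r : ι' → ι) :
    Similar f f' (v ∘ r) (v' ∘ r) where
  ker_eq := ker_comp_eq_ker_comp h.ker_eq r
  isLeft_eq p := h.isLeft_eq (r p)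
  ker_nodes_eq := by
    have hnodes {M : Multigraph} (f : A.X ↪ M.X) (v : ι → M.Point) :
        nodes f (v ∘ r) = nodes f v ∘ Sum.map id (Prod.map r id) := by
      ext (a | σ) <;> rfl
    rw [hnodes, hnodes]
    exact ker_comp_eq_ker_comp h.ker_nodes_eq _

theorem adj_iff (h : Similar f f' v v') (p q : ι) :
    M.subdivision.Adj (v p) (v q) ↔ M'.subdivision.Adj (v' p) (v' q) := by
  have hends := ker_eq_ker_iff.1 h.ker_nodes_eq (.inr (p, true)) (.inr (q, false))
  rw [subdivision_adj_iff, subdivision_adj_iff, h.isLeft_eq, h.isLeft_eq]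
  exact and_congr_right fun _ => hends

/-- The nodes relevant to `v`, preceded by two further nodes. -/
abbrev nodesWith (f : A.X ↪ M.X) (v : ι → M.Point) (x y : M.X) :
    Option (Option (A.X ⊕ (ι × Bool))) → M.X :=
  fun o => o.elim y fun o => o.elim x (nodes f v)

theorem exists_ker_nodesWith_eq [Finite ι] (hf' : IsGeneric k f') (hι : Nat.card ι < k)
    (h : Similar f f' v v') (x y : M.X) : ∃ x' y' : M'.X,
      Setoid.ker (nodesWith f v x y) = Setoid.ker (nodesWith f' v' x' y') := by
  have not_surjective {κ : Type} [Finite κ] (hκ : Nat.card κ < Nat.card A.X + 2 * k)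
      (z : κ → M'.X) : ¬ Function.Surjective z := fun hz =>
    (hκ.trans_le hf'.card_le).not_ge (Nat.card_le_card_of_surjective z hz)
  have hcard : Nat.card (A.X ⊕ (ι × Bool)) = Nat.card A.X + 2 * Nat.card ι := by
    simp [Nat.card_sum, mul_comm]
  obtain ⟨x', hx⟩ := exists_ker_optionElim_eq h.ker_nodes_eq (not_surjective (by lia) _) x
  obtain ⟨y', hxy⟩ := exists_ker_optionElim_eq hx
    (not_surjective (by rw [Finite.card_option]; lia) _) y
  exact ⟨x', y', hxy⟩

section Edge

variable {x y : M.X} {x' y' : M'.X} (hxy : Setoid.ker (nodesWith f v x y) =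
  Setoid.ker (nodesWith f' v' x' y'))
include hxy

theorem mem_range_edge_iff (h : Similar f f' v v') (p : ι) :
    v p ∈ Set.range (M.edge x y) ↔ v' p ∈ Set.range (M'.edge x' y') := by
  have hx : M.endpoint (v p) false = x ↔ M'.endpoint (v' p) false = x' :=
    ker_eq_ker_iff.1 hxy (some (some (.inr (p, false)))) (some none)
  have hy : M.endpoint (v p) true = y ↔ M'.endpoint (v' p) true = y' :=
    ker_eq_ker_iff.1 hxy (some (some (.inr (p, true)))) none
  rw [Multigraph.mem_range_edge_iff, Multigraph.mem_range_edge_iff, h.isLeft_eq, hx, hy]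

theorem mult_eq_or_le_mult (hf : Extends k f) (hf' : Extends k f') :
    M.mult x y = M'.mult x' y' ∨ k ≤ M'.mult x' y' := by
  by_cases hA : x' ∉ Set.range f' ∨ y' ∉ Set.range f'
  · exact .inr (hf'.le_mult x' y' hA)
  · push Not at hA
    obtain ⟨⟨a, rfl⟩, ⟨b, rfl⟩⟩ := hA
    have hx : f a = x := (ker_eq_ker_iff.1 hxy (some (some (.inl a))) (some none)).2 rfl
    have hy : f b = y := (ker_eq_ker_iff.1 hxy (some (some (.inl b))) none).2 rfl
    rw [← hx, ← hy, hf.mult_eq, hf'.mult_eq]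
    exact .inl rfl

theorem exists_edge_notMem_range [Finite ι] (hf : Extends k f) (hf' : Extends k f')
    (hι : Nat.card ι < k) (h : Similar f f' v v') {c : Fin (M.mult x y)}
    (hc : M.edge x y c ∉ Set.range v) : ∃ c', M'.edge x' y' c' ∉ Set.range v' := by
  by_contra! hused
  choose p hp using hused
  have hp_inj : Function.Injective p := fun c d hcd =>
    edge_injective x' y' (by rw [← hp c, ← hp d, hcd])
  rcases mult_eq_or_le_mult hxy hf hf' with hmult | hmult
  · choose d hd using fun c => (mem_range_edge_iff hxy h (p c)).2 ⟨c, (hp c).symm⟩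
    have hd_inj : Function.Injective d := fun i j hij => by
      have hv : v (p i) = v (p j) := by rw [← hd, ← hd, hij]
      rw [ker_eq_ker_iff.1 h.ker_eq, hp, hp] at hv
      exact edge_injective x' y' hv
    obtain ⟨i, rfl⟩ := (hd_inj.bijective_of_nat_card_le (by simp [hmult])).surjective c
    exact hc ⟨p i, (hd i).symm⟩
  · have hcard := Nat.card_le_card_of_injective p hp_inj
    rw [Nat.card_fin] at hcard
    lia

theorem exists_ker_edge_eq [Finite ι] (hf : Extends k f) (hf' : Extends k f')
    (hι : Nat.card ι < k) (h : Similar f f' v v') (c : Fin (M.mult x y)) :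
    ∃ c', Setoid.ker (fun o : Option ι => o.elim (M.edge x y c) v) =
      Setoid.ker fun o : Option ι => o.elim (M'.edge x' y' c') v' := by
  by_cases hc : M.edge x y c ∈ Set.range v
  · obtain ⟨p, hp⟩ := hc
    obtain ⟨c', hc'⟩ := (mem_range_edge_iff hxy h p).1 ⟨c, hp.symm⟩
    refine ⟨c', ker_optionElim_eq_ker_optionElim h.ker_eq fun q => ?_⟩
    rw [← hp, hc', ker_eq_ker_iff.1 h.ker_eq]
  · obtain ⟨c', hc'⟩ := exists_edge_notMem_range hxy hf hf' hι h hc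
    exact ⟨c', ker_optionElim_eq_ker_optionElim h.ker_eq fun p =>
      iff_of_false (fun hp => hc ⟨p, hp⟩) fun hp => hc' ⟨p, hp⟩⟩

end Edge

/-- Placing a further pebble on `w` adds both endpoints of `w` to the relevant nodes, so that its
new equality pattern is that of the old nodes together with these endpoints. -/
theorem optionElim (h : Similar f f' v v') {w : M.Point} {w' : M'.Point}
    (hw : w.isLeft = w'.isLeft)
    (hker : Setoid.ker (fun o : Option ι => o.elim w v) =
      Setoid.ker fun o : Option ι => o.elim w' v')
    (hnodes : Setoid.ker (nodesWith f v (M.endpoint w false) (M.endpoint w true)) =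
      Setoid.ker (nodesWith f' v' (M'.endpoint w' false) (M'.endpoint w' true))) :
    Similar f f' (fun o : Option ι => o.elim w v) fun o : Option ι => o.elim w' v' where
  ker_eq := hker
  isLeft_eq := by
    rintro (_ | p)
    exacts [hw, h.isLeft_eq p]
  ker_nodes_eq := by
    let r : A.X ⊕ (Option ι × Bool) → Option (Option (A.X ⊕ (ι × Bool)))
      | .inl a => some (some (.inl a))
      | .inr (some p, s) => some (some (.inr (p, s)))
      | .inr (none, false) => some none
      | .inr (none, true) => none
    have hr {M : Multigraph} (f : A.X ↪ M.X) (v : ι → M.Point) (w : M.Point) :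
        nodes f (fun o : Option ι => o.elim w v) =
          nodesWith f v (M.endpoint w false) (M.endpoint w true) ∘ r := by
      ext (a | ⟨_ | p, _ | _⟩) <;> rfl
    rw [hr, hr]
    exact ker_comp_eq_ker_comp hnodes r

theorem exists_optionElim [Finite ι] (hf : Extends k f) (hf' : IsGeneric k f')
    (hι : Nat.card ι < k) (h : Similar f f' v v') (w : M.Point) : ∃ w' : M'.Point,
      Similar f f' (fun o : Option ι => o.elim w v) fun o : Option ι => o.elim w' v' := by
  obtain ⟨x', y', hxy⟩ :=
    h.exists_ker_nodesWith_eq hf' hι (M.endpoint w false) (M.endpoint w true)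
  rcases w with x | ⟨⟨x, y⟩, c⟩
  · obtain rfl : x' = y' := (ker_eq_ker_iff.1 hxy (some none) none).1 rfl
    refine ⟨.inl x', h.optionElim rfl (ker_optionElim_eq_ker_optionElim h.ker_eq fun p => ?_) hxy⟩
    rw [eq_inl_iff, eq_inl_iff, h.isLeft_eq]
    exact and_congr_right fun _ =>
      ker_eq_ker_iff.1 hxy (some (some (.inr (p, false)))) (some none)
  · obtain ⟨c', hc⟩ := exists_ker_edge_eq hxy hf hf'.toExtends hι h c
    exact ⟨M'.edge x' y' c', h.optionElim rfl hc hxy⟩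

theorem exists_update {v : Fin k → M.Point} {v' : Fin k → M'.Point} (hf : Extends k f)
    (hf' : IsGeneric k f') (h : Similar f f' v v') (i : Fin k) (w : M.Point) :
    ∃ w', Similar f f' (Function.update v i w) (Function.update v' i w') := by
  have hcard : Nat.card {j // j ≠ i} < k :=
    (Finite.card_subtype_lt (p := (· ≠ i)) (not_not.2 rfl)).trans_eq (Nat.card_fin k)
  have hupdate {α : Type} (v : Fin k → α) (w : α) : Function.update v i w =
      (fun o : Option {j // j ≠ i} => o.elim w (v ∘ (↑))) ∘ (Equiv.optionSubtypeNe i).symm := by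
    ext j
    by_cases hj : j = i <;> simp [hj]
  obtain ⟨w', h'⟩ := (h.comp ((↑) : {j // j ≠ i} → Fin k)).exists_optionElim hf hf' hcard w
  refine ⟨w', ?_⟩
  rw [hupdate, hupdate]
  exact h'.comp _

theorem sat_iff (hf : IsGeneric k f) (hf' : IsGeneric k f') (φ : InfFormula.{u} k)
    {v : Fin k → M.Point} {v' : Fin k → M'.Point} (h : Similar f f' v v') :
    φ.Sat M.subdivision v ↔ φ.Sat M'.subdivision v' := by
  have forth {v v'} (h : Similar f f' v v') (i : Fin k) (w : M.Point) :=
    h.exists_update hf.toExtends hf' i w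
  have back {v v'} (h : Similar f f' v v') (i : Fin k) (w' : M'.Point) :
      ∃ w, Similar f f' (Function.update v i w) (Function.update v' i w') :=
    (h.symm.exists_update hf'.toExtends hf i w').imp fun _ => symm
  induction φ generalizing v v' with
  | equal i j => exact ker_eq_ker_iff.1 h.ker_eq i j
  | adj i j => exact h.adj_iff i j
  | neg φ ih => exact not_congr (ih h)
  | ex i φ ih =>
    exact ⟨fun ⟨w, hw⟩ => (forth h i w).imp fun _ h' => (ih h').1 hw,
      fun ⟨w', hw'⟩ => (back h i w').imp fun _ h' => (ih h').2 hw'⟩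
  | all i φ ih =>
    exact ⟨fun hw w' => let ⟨w, h'⟩ := back h i w'; (ih h').1 (hw w),
      fun hw' w => let ⟨w', h'⟩ := forth h i w; (ih h').2 (hw' w')⟩
  | disj φ ih => exact exists_congr fun j => ih j h
  | conj φ ih => exact forall_congr' fun j => ih j h

end Similar

end Game

end Multigraph

/-! ### Reading a multigraph off its subdivision -/

/-- At least two edges leave `x`. In the subdivision of a multigraph with all multiplicities at
least `2` this distinguishes the nodes from the edges. -/
def IsBranching {V : Type} (G : Digraph V) (x : V) : Prop :=
  ∃ y z, y ≠ z ∧ G.Adj x y ∧ G.Adj x z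

/-- There are at least `q` paths of length two from `x` to `y`. In a subdivision they are the edges
from `x` to `y`. -/
def HasPaths {V : Type} (G : Digraph V) (q : ℕ) (x y : V) : Prop :=
  ∃ z : Fin q → V, Function.Injective z ∧ ∀ i, G.Adj x (z i) ∧ G.Adj (z i) y

/-- There are exactly `q` paths of length two from `x` to `y`. -/
def HasExactPaths {V : Type} (G : Digraph V) (q : ℕ) (x y : V) : Prop :=
  HasPaths G q x y ∧ ¬ HasPaths G (q + 1) x y

/-- The counterpart of `Multigraph.endpoint` for a directed graph that is treated as a subdivision:
the point `x` is the source (`s = false`) or the target (`s = true`) of `z`. -/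
def IsEndpoint {V : Type} (G : Digraph V) (z : V) (s : Bool) (x : V) : Prop :=
  IsBranching G x ∧ (z = x ∨ ¬ IsBranching G z ∧ bif s then G.Adj z x else G.Adj x z)

namespace FODefinable

variable {α : Type}

theorem isBranching (a : α) : FODefinable fun _ G v => IsBranching G (v a) :=
  .ex (.ex (.and (.not (.eq (α := (α ⊕ Unit) ⊕ Unit) (.inl (.inr ())) (.inr ())))
    (.and (.adj (α := (α ⊕ Unit) ⊕ Unit) (.inl (.inl a)) (.inl (.inr ())))
      (.adj (α := (α ⊕ Unit) ⊕ Unit) (.inl (.inl a)) (.inr ())))))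

theorem hasPaths (q : ℕ) (a b : α) : FODefinable fun _ G v => HasPaths G q (v a) (v b) :=
  .exs (.and
    (.iAnd fun i => .iAnd fun j => .imp (.eq (α := α ⊕ Fin q) (.inr i) (.inr j)) (.const (i = j)))
    (.iAnd fun i => .and (.adj (α := α ⊕ Fin q) (.inl a) (.inr i))
      (.adj (α := α ⊕ Fin q) (.inr i) (.inl b))))

theorem hasExactPaths (q : ℕ) (a b : α) :
    FODefinable fun _ G v => HasExactPaths G q (v a) (v b) :=
  (hasPaths q a b).and (hasPaths (q + 1) a b).not

theorem isEndpoint (a : α) (s : Bool) (b : α) :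
    FODefinable fun _ G v => IsEndpoint G (v a) s (v b) :=
  have hadj : FODefinable fun _ G v => bif s then G.Adj (v a) (v b) else G.Adj (v b) (v a) :=
    match s with
    | false => adj b a
    | true => adj a b
  (isBranching b).and ((eq a b).or ((isBranching a).not.and hadj))

end FODefinable

namespace Multigraph

variable {M : Multigraph}

theorem isBranching_subdivision (hM : ∀ x y, 2 ≤ M.mult x y) {z : M.Point} :
    IsBranching M.subdivision z ↔ z.isLeft = true := by
  rcases z with x | e
  · refine iff_of_true ⟨M.edge x x ⟨0, two_pos.trans_le (hM x x)⟩, M.edge x x ⟨1, hM x x⟩,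
      fun h => ?_, rfl, rfl⟩ rfl
    simpa using edge_injective x x h
  · refine iff_of_false ?_ (by simp)
    rintro ⟨y | y, z | z, hyz, hy, hz⟩ <;> simp only [subdivision] at hy hz
    exact hyz (by rw [← hy, ← hz])

theorem isEndpoint_subdivision (hM : ∀ x y, 2 ≤ M.mult x y) {z w : M.Point} {s : Bool} :
    IsEndpoint M.subdivision z s w ↔ w = .inl (M.endpoint z s) := by
  rw [IsEndpoint, isBranching_subdivision hM, isBranching_subdivision hM]
  rcases w with y | e'
  · rcases z with x | e
    · simp [endpoint, eq_comm]
    · cases s <;> simp [subdivision, endpoint, eq_comm]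
  · simp

theorem adj_adj_iff_mem_range_edge {x y : M.X} {z : M.Point} :
    M.subdivision.Adj (.inl x) z ∧ M.subdivision.Adj z (.inl y) ↔ z ∈ Set.range (M.edge x y) := by
  rw [mem_range_edge_iff]
  rcases z with w | e <;> simp [subdivision, endpoint]

theorem hasPaths_subdivision {q : ℕ} {x y : M.X} :
    HasPaths M.subdivision q (.inl x) (.inl y) ↔ q ≤ M.mult x y := by
  simp only [HasPaths, adj_adj_iff_mem_range_edge]
  constructor
  · rintro ⟨z, hz, hedge⟩
    choose c hc using hedge
    have hc_inj : Function.Injective c := fun i j hij => hz (by rw [← hc, ← hc, hij])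
    simpa using Nat.card_le_card_of_injective c hc_inj
  · intro h
    exact ⟨M.edge x y ∘ Fin.castLE h, (edge_injective x y).comp (Fin.castLE_injective h),
      fun i => ⟨_, rfl⟩⟩

theorem hasExactPaths_subdivision {q : ℕ} {x y : M.X} :
    HasExactPaths M.subdivision q (.inl x) (.inl y) ↔ M.mult x y = q := by
  rw [HasExactPaths, hasPaths_subdivision, hasPaths_subdivision]
  lia

theorem eq_inl_of_hasPaths {q : ℕ} (hq : 2 ≤ q) {z w : M.Point}
    (h : HasPaths M.subdivision q z w) : ∃ x, z = .inl x := by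
  rcases z with x | e
  · exact ⟨x, rfl⟩
  · obtain ⟨p, hp, hadj⟩ := h
    have heq : ∀ t, M.subdivision.Adj (.inr e) t → t = .inl e.1.2
      | .inl _, ht => congrArg Sum.inl ht.symm
      | .inr _, ht => ht.elim
    have hzero_one : (⟨0, by lia⟩ : Fin q) = ⟨1, hq⟩ :=
      hp ((heq _ (hadj _).1).trans (heq _ (hadj _).1).symm)
    simp at hzero_one

end Multigraph

/-! ### Recording profiles in multiplicities -/

/-- What a tuple of points of a subdivision says about itself: the equalities between its members,
the set of those that are nodes, and the equalities between endpoints. -/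
abbrev Pattern (ι : Type) : Type := Setoid ι × Set ι × Setoid (ι × Bool)

/-- What a tuple of points of the subdivision of an extension says about itself and its position
over the set `B` of nodes of the original multigraph: its pattern and, for every `a : B`, the set of
endpoints that are equal to `a`. -/
abbrev Profile (B ι : Type) : Type := Pattern ι × (B → Set (ι × Bool))

instance {ι : Type} [Finite ι] : Finite (Setoid ι) :=
  .of_injective (fun s : Setoid ι => (s : ι → ι → Prop)) fun _ _ => Setoid.eq_iff_rel_eq.2

namespace Multigraph

section Profile

variable {A M M' : Multigraph} {k : ℕ} {ι : Type}

/-- The pattern of a tuple of points of the subdivision of `M`. -/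
def pattern (M : Multigraph) (v : ι → M.Point) : Pattern ι :=
  (Setoid.ker v, {p | (v p).isLeft = true}, Setoid.ker fun σ : ι × Bool => M.endpoint (v σ.1) σ.2)

/-- The profile of a tuple of points of the subdivision of an extension of `A`. -/
def profile (f : A.X ↪ M.X) (v : ι → M.Point) : Profile A.X ι :=
  (M.pattern v, fun a => {σ | M.endpoint (v σ.1) σ.2 = f a})

theorem Similar.of_profile_eq {f : A.X ↪ M.X} {f' : A.X ↪ M'.X} {v : ι → M.Point}
    {v' : ι → M'.Point} (h : profile f v = profile f' v') : Similar f f' v v' := by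
  simp only [profile, pattern, Prod.mk.injEq, funext_iff, Set.ext_iff] at h
  obtain ⟨⟨hker, hleft, hends⟩, hbase⟩ := h
  exact ⟨hker, fun p => Bool.eq_iff_iff.2 (hleft p),
    (ker_sumElim_eq_ker_sumElim_iff f.injective f'.injective).2 ⟨hends, hbase⟩⟩

/-- The profiles of the tuples that satisfy `φ` in the generic extensions of `A`. -/
def trueProfiles (A : Multigraph) (φ : InfFormula.{u} k) : Set (Profile A.X (Fin k)) :=
  {τ | ∃ (M : Multigraph) (f : A.X ↪ M.X) (v : Fin k → M.Point),
    IsGeneric k f ∧ profile f v = τ ∧ φ.Sat M.subdivision v}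

theorem profile_mem_trueProfiles_iff {f : A.X ↪ M.X} (hf : IsGeneric k f) (φ : InfFormula.{u} k)
    {v : Fin k → M.Point} : profile f v ∈ A.trueProfiles φ ↔ φ.Sat M.subdivision v := by
  refine ⟨?_, fun hv => ⟨M, f, v, hf, rfl, hv⟩⟩
  rintro ⟨M', f', v', hf', hprofile, hv'⟩
  exact (Similar.sat_iff hf' hf φ (.of_profile_eq hprofile)).1 hv'

end Profile

end Multigraph

/-- The labels that multiplicities carry: the pattern of a tuple, or the set of the endpoints of a
tuple that are equal to a given node. -/
abbrev Label (k : ℕ) : Type := Pattern (Fin k) ⊕ Set (Fin k × Bool)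

/-- A numbering of the labels that starts from `k`, so that multiplicities which carry a label
cannot be distinguished with `k` pebbles. -/
noncomputable def Label.code {k : ℕ} (l : Label k) : ℕ :=
  k + Finite.equivFin (Label k) l

namespace Label

variable {k : ℕ} {l l' : Label k}

theorem le_code : k ≤ l.code := Nat.le_add_right _ _

theorem code_lt : l.code < k + Nat.card (Label k) :=
  Nat.add_lt_add_left (Fin.isLt _) k

theorem code_inj : l.code = l'.code ↔ l = l' := by
  simp [code, Fin.val_inj]

end Label

namespace Multigraph

section Record

variable {A : Multigraph} {k N : ℕ}

/-- The extension of `A` by one node for each profile in `T` and by `2 * k` further nodes. The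
multiplicities of the edges that leave the node of a profile describe this profile: those of the
edges to a node of `A` the endpoints equal to that node, and those of the edges to the nodes of
profiles, in particular of the loops, the pattern. All other new multiplicities carry the irrelevant
label `.inr ∅`. -/
noncomputable def record (A : Multigraph) (T : Set (Profile A.X (Fin k))) (N : ℕ) : Multigraph where
  X := A.X ⊕ (T ⊕ Fin (2 * k))
  mult
    | .inl a, .inl b => A.mult a b
    | .inr (.inl τ), .inl a => N + Label.code (k := k) (.inr (τ.1.2 a))
    | .inr (.inl τ), .inr (.inl _) => N + Label.code (.inl τ.1.1)
    | _, _ => N + Label.code (k := k) (.inr ∅)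

/-- The inclusion of `A` into the extension that records a set of profiles. -/
def toRecord (A : Multigraph) (T : Set (Profile A.X (Fin k))) (N : ℕ) :
    A.X ↪ (A.record T N).X :=
  .inl

/-- The node of the recording extension that stands for a given profile. -/
def profileNode {A : Multigraph} {T : Set (Profile A.X (Fin k))} (τ : T) : (A.record T N).X :=
  .inr (.inl τ)

variable {T : Set (Profile A.X (Fin k))}

theorem mult_profileNode_self (τ : T) :
    (A.record T N).mult (profileNode τ) (profileNode τ) = N + Label.code (.inl τ.1.1) := rfl

theorem mult_profileNode_toRecord (τ : T) (a : A.X) :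
    (A.record T N).mult (profileNode τ) (A.toRecord T N a) =
      N + Label.code (k := k) (.inr (τ.1.2 a)) := rfl

theorem extends_toRecord : Extends (N + k) (A.toRecord T N) where
  mult_eq _ _ := rfl
  le_mult := by
    rintro (a | a | a) (b | b | b) h
    · exact h.elim (fun h => (h ⟨a, rfl⟩).elim) fun h => (h ⟨b, rfl⟩).elim
    all_goals exact Nat.add_le_add_left Label.le_code N

theorem isGeneric_toRecord : IsGeneric k (A.toRecord T N) where
  toExtends := extends_toRecord.mono (Nat.le_add_left k N)
  card_le := by
    have hcard := Nat.card_le_card_of_injective _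
      (Sum.map_injective.2 ⟨Function.injective_id, Sum.inr_injective⟩ :
        Function.Injective (Sum.map id Sum.inr : A.X ⊕ Fin (2 * k) → (A.record T N).X))
    rwa [Nat.card_sum, Nat.card_fin] at hcard

theorem record_mult_lt (hA : ∀ x y, A.mult x y < N) (x y : (A.record T N).X) :
    (A.record T N).mult x y < N + (k + Nat.card (Label k)) := by
  have hcode (l : Label k) : N + l.code < N + (k + Nat.card (Label k)) :=
    Nat.add_lt_add_left Label.code_lt N
  rcases x with a | τ | i <;> rcases y with b | _ | _
  · exact (hA a b).trans_le (Nat.le_add_right _ _)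
  all_goals exact hcode _

end Record

end Multigraph

/-! ### Recognising recorded profiles -/

section Recorded

variable {V : Type} (G : Digraph V) {k : ℕ}

/-- The counterpart of `Multigraph.pattern` for a directed graph that is treated as a
subdivision. -/
def HasPattern (π : Pattern (Fin k)) (v : Fin k → V) : Prop :=
  (∀ p q, v p = v q ↔ π.1 p q) ∧ (∀ p, IsBranching G (v p) ↔ p ∈ π.2.1) ∧
    ∀ σ τ, (∃ x, IsEndpoint G (v σ.1) σ.2 x ∧ IsEndpoint G (v τ.1) τ.2 x) ↔ π.2.2 σ τ

/-- The endpoints of `v` that are equal to `a` form the set `S`. -/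
def HasEndpointsAt (a : V) (S : Set (Fin k × Bool)) (v : Fin k → V) : Prop :=
  ∀ σ, IsEndpoint G (v σ.1) σ.2 a ↔ σ ∈ S

/-- The point `x` is a node with fewer than `N` loops; when the multiplicities from `N` on are
those of a recording extension and its extensions, these are the nodes that existed before. -/
def IsLow (N : ℕ) (x : V) : Prop :=
  IsBranching G x ∧ ¬ HasPaths G N x x

/-- The multiplicities from `N` on show that some node records the profile of `v`. -/
def IsRecorded (N : ℕ) (v : Fin k → V) : Prop :=
  ∃ x, (∃ π, HasPattern G π v ∧ HasExactPaths G (N + Label.code (.inl π)) x x) ∧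
    ∀ a, IsLow G N a →
      ∃ S, HasEndpointsAt G a S v ∧ HasExactPaths G (N + Label.code (k := k) (.inr S)) x a

end Recorded

namespace FODefinable

variable {α : Type} {k : ℕ}

theorem hasPattern (π : Pattern (Fin k)) (f : Fin k → α) :
    FODefinable fun _ G v => HasPattern G π fun p => v (f p) :=
  .and (.iAnd fun p => .iAnd fun q => .iff (.eq (f p) (f q)) (.const (π.1 p q)))
    (.and (.iAnd fun p => .iff (.isBranching (f p)) (.const (p ∈ π.2.1)))
      (.iAnd fun σ => .iAnd fun τ => .iff
        (.ex (.and (.isEndpoint (α := α ⊕ Unit) (.inl (f σ.1)) σ.2 (.inr ()))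
          (.isEndpoint (α := α ⊕ Unit) (.inl (f τ.1)) τ.2 (.inr ())))) (.const (π.2.2 σ τ))))

theorem hasEndpointsAt (a : α) (S : Set (Fin k × Bool)) (f : Fin k → α) :
    FODefinable fun _ G v => HasEndpointsAt G (v a) S fun p => v (f p) :=
  .iAnd fun σ => .iff (.isEndpoint (f σ.1) σ.2 a) (.const (σ ∈ S))

theorem isLow (N : ℕ) (a : α) : FODefinable fun _ G v => IsLow G N (v a) :=
  (isBranching a).and (hasPaths N a a).not

theorem isRecorded (N : ℕ) : FODefinable fun _ G (v : Fin k → _) => IsRecorded G N v :=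
  .ex (.and
    (.iOr fun π => .and (.hasPattern (α := Fin k ⊕ Unit) π .inl)
      (.hasExactPaths (α := Fin k ⊕ Unit) _ (.inr ()) (.inr ())))
    (.all (.imp (.isLow (α := (Fin k ⊕ Unit) ⊕ Unit) N (.inr ()))
      (.iOr fun S => .and
        (.hasEndpointsAt (α := (Fin k ⊕ Unit) ⊕ Unit) (.inr ()) S fun p => .inl (.inl p))
        (.hasExactPaths (α := (Fin k ⊕ Unit) ⊕ Unit) _ (.inl (.inr ())) (.inr ()))))))

end FODefinable

namespace Multigraph

variable {A M : Multigraph} {k N : ℕ}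

theorem hasPattern_subdivision (hM : ∀ x y, 2 ≤ M.mult x y) {π : Pattern (Fin k)}
    {v : Fin k → M.Point} : HasPattern M.subdivision π v ↔ M.pattern v = π := by
  simp only [HasPattern, isBranching_subdivision hM, isEndpoint_subdivision hM, exists_eq_left,
    Sum.inl.injEq, pattern, Prod.ext_iff, Setoid.ext_iff, Set.ext_iff, Set.mem_ofPred_eq,
    Setoid.ker_def]

theorem hasEndpointsAt_subdivision (hM : ∀ x y, 2 ≤ M.mult x y) {a : M.X}
    {S : Set (Fin k × Bool)} {v : Fin k → M.Point} :
    HasEndpointsAt M.subdivision (.inl a) S v ↔ {σ | M.endpoint (v σ.1) σ.2 = a} = S := by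
  simp only [HasEndpointsAt, isEndpoint_subdivision hM, Sum.inl.injEq, Set.ext_iff,
    Set.mem_ofPred_eq, eq_comm (a := a)]

theorem isLow_subdivision {f : A.X ↪ M.X} (hf : Extends N f) (hA : ∀ a, A.mult a a < N)
    (hM : ∀ x y, 2 ≤ M.mult x y) {z : M.Point} :
    IsLow M.subdivision N z ↔ ∃ a, z = .inl (f a) := by
  simp only [IsLow, isBranching_subdivision hM, Sum.isLeft_iff]
  constructor
  · rintro ⟨⟨x, rfl⟩, hx⟩
    rw [hasPaths_subdivision, not_le] at hx
    obtain ⟨a, rfl⟩ := (hf.mem_range_of_mult_lt hx).1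
    exact ⟨a, rfl⟩
  · rintro ⟨a, rfl⟩
    rw [hasPaths_subdivision, hf.mult_eq, not_le]
    exact ⟨⟨f a, rfl⟩, hA a⟩

section Recorded

variable {T : Set (Profile A.X (Fin k))} {g : (A.record T N).X ↪ M.X}
  (hg : Extends (N + (k + Nat.card (Label k))) g)
include hg

theorem hasExactPaths_code_inl_iff (hN : 2 ≤ N) (hA : ∀ a, A.mult a a < N) {z : M.Point}
    {π : Pattern (Fin k)} : HasExactPaths M.subdivision (N + Label.code (.inl π)) z z ↔
      ∃ τ : T, τ.1.1 = π ∧ z = .inl (g (profileNode τ)) := by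
  constructor
  · intro h
    obtain ⟨x, rfl⟩ := eq_inl_of_hasPaths (by lia) h.1
    rw [hasExactPaths_subdivision] at h
    have hlt : M.mult x x < N + (k + Nat.card (Label k)) :=
      h.trans_lt (Nat.add_lt_add_left Label.code_lt N)
    obtain ⟨y, rfl⟩ := (hg.mem_range_of_mult_lt hlt).1
    rw [hg.mult_eq] at h
    rcases y with a | τ | i
    · exact absurd h ((hA a).trans_le (Nat.le_add_right _ _)).ne
    · exact ⟨τ, Sum.inl_injective (Label.code_inj.1 (Nat.add_left_cancel h)), rfl⟩
    · simpa using Label.code_inj.1 (Nat.add_left_cancel h)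
  · rintro ⟨τ, rfl, rfl⟩
    rw [hasExactPaths_subdivision, hg.mult_eq, mult_profileNode_self]

theorem hasExactPaths_code_inr_iff {τ : T} {a : A.X} {S : Set (Fin k × Bool)} :
    HasExactPaths M.subdivision (N + Label.code (k := k) (.inr S)) (.inl (g (profileNode τ)))
      (.inl (g (A.toRecord T N a))) ↔ τ.1.2 a = S := by
  rw [hasExactPaths_subdivision, hg.mult_eq, mult_profileNode_toRecord, Nat.add_left_cancel_iff,
    Label.code_inj, Sum.inr.injEq]

theorem isRecorded_subdivision_iff (hN : 2 ≤ N) (hA : ∀ a, A.mult a a < N)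
    (hM : ∀ x y, 2 ≤ M.mult x y) {v : Fin k → M.Point} :
    IsRecorded M.subdivision N v ↔ profile ((A.toRecord T N).trans g) v ∈ T := by
  have hlow {z : M.Point} := isLow_subdivision (z := z)
    ((extends_toRecord.mono (Nat.le_add_right N k)).trans hg (Nat.le_add_right _ _)) hA hM
  constructor
  · rintro ⟨x, ⟨π, hπ, hx⟩, hbase⟩
    obtain ⟨τ, rfl, rfl⟩ := (hasExactPaths_code_inl_iff hg hN hA).1 hx
    suffices hτ : profile ((A.toRecord T N).trans g) v = τ from hτ ▸ τ.2
    refine Prod.ext ((hasPattern_subdivision hM).1 hπ) (funext fun a => ?_)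
    obtain ⟨S, hS, hxS⟩ := hbase _ (hlow.2 ⟨a, rfl⟩)
    exact ((hasEndpointsAt_subdivision hM).1 hS).trans ((hasExactPaths_code_inr_iff hg).1 hxS).symm
  · intro hv
    refine ⟨.inl (g (profileNode ⟨_, hv⟩)), ⟨M.pattern v, (hasPattern_subdivision hM).2 rfl,
      (hasExactPaths_code_inl_iff hg hN hA).2 ⟨_, rfl, rfl⟩⟩, fun z hz => ?_⟩
    obtain ⟨a, rfl⟩ := hlow.1 hz
    exact ⟨_, (hasEndpointsAt_subdivision hM).2 rfl, (hasExactPaths_code_inr_iff hg).2 rfl⟩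

end Recorded

end Multigraph

/-! ### Inductions along chains -/

/-- The inclusion of the vocabulary of graphs into its expansion by `P`. -/
def graphLHom (r : ℕ) : Language.graph →ᴸ indLanguage r where
  onFunction _ f := Empty.elim f
  onRelation | _, .adj => .adj

theorem isExpansionOn_graphLHom {V : Type} (G : Digraph V) {r : ℕ} (R : Set (Fin r → V)) :
    letI := graphStructure G
    letI := indStructure G R
    (graphLHom r).IsExpansionOn V :=
  let _ := graphStructure G
  let _ := indStructure G R
  { map_onFunction := fun f => f.elim
    map_onRelation := fun {n} S x => by cases S; rfl }

theorem polarity_onBoundedFormula {r : ℕ} {α : Type} {n : ℕ}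
    (φ : Language.graph.BoundedFormula α n) (b : Bool) :
    Polarity b ((graphLHom r).onBoundedFormula φ) := by
  induction φ generalizing b with
  | falsum => trivial
  | equal => trivial
  | rel S ts => cases S; exact fun h => h.elim
  | imp _ _ ih₁ ih₂ => exact ⟨ih₁ _, ih₂ _⟩
  | all _ ih => exact ih _

/-- The formula `∀ w, χ(w, v) → P(w)`. -/
def progressFormula (χ : Language.graph.Formula (Fin 2)) :
    (indLanguage 1).Formula (Fin 1 ⊕ Fin 0) :=
  let ξ : Language.graph.BoundedFormula (Fin 1 ⊕ Fin 0) 1 :=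
    Language.BoundedFormula.relabel (n := 1) (k := 0) ![.inr 0, .inl (.inl 0)] χ
  .all (.imp ((graphLHom 1).onBoundedFormula ξ) (.rel IndRel.P fun _ => .var (.inr 0)))

/-- The induction that adds `v` to `P` once `P` contains all `w` with `χ(w, v)`. -/
abbrev wellFoundedPart (χ : Language.graph.Formula (Fin 2)) : PosInduction where
  r := 1
  p := 0
  formula := progressFormula χ
  positive := ⟨polarity_onBoundedFormula _ _, fun _ => rfl⟩

theorem realize_progressFormula (χ : Language.graph.Formula (Fin 2)) {V : Type} (G : Digraph V)
    (S : Set (Fin 1 → V)) (v : Fin 1 → V) (a : Fin 0 → V) :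
    letI := indStructure G S
    (progressFormula χ).Realize (Sum.elim v a) ↔ ∀ w, FOSat G χ ![w, v 0] → (fun _ => w) ∈ S := by
  let _ := graphStructure G
  let _ := indStructure G S
  have := isExpansionOn_graphLHom G S
  refine forall_congr' fun w => imp_congr ?_ Iff.rfl
  refine (Language.LHom.realize_onBoundedFormula _ _).trans
    (Language.BoundedFormula.realize_relabel.trans ?_)
  refine iff_of_eq (congrArg₂ _ ?_ (Subsingleton.elim _ _))
  ext p
  fin_cases p <;> simp [Fin.snoc]

theorem mem_wellFoundedPart_stage_succ (χ : Language.graph.Formula (Fin 2)) {V : Type}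
    (G : Digraph V) (a : Fin 0 → V) (i : ℕ) (v : Fin 1 → V) :
    v ∈ (wellFoundedPart χ).stage G a (i + 1) ↔
      ∀ w, FOSat G χ ![w, v 0] → (fun _ => w) ∈ (wellFoundedPart χ).stage G a i :=
  realize_progressFormula χ G _ v a

theorem mem_wellFoundedPart_stage_iff_of_chain {χ : Language.graph.Formula (Fin 2)} {V : Type}
    {G : Digraph V} {n : ℕ} {f : Fin n → V}
    (hf : ∀ w b, FOSat G χ ![w, f b] ↔ ∃ a, a.val + 1 = b.val ∧ w = f a) (a : Fin 0 → V) (i : ℕ)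
    (b : Fin n) : (fun _ => f b) ∈ (wellFoundedPart χ).stage G a i ↔ b < i := by
  induction i generalizing b with
  | zero => exact iff_of_false (fun h => h) (Nat.not_lt_zero _)
  | succ i ih =>
    rw [mem_wellFoundedPart_stage_succ]
    simp only [hf]
    constructor
    · intro h
      rcases b with ⟨_ | b, hb⟩
      · exact i.succ_pos
      · exact Nat.succ_lt_succ ((ih ⟨b, by lia⟩).1 (h _ ⟨⟨b, by lia⟩, rfl, rfl⟩))
    · rintro hb w ⟨a, hab, rfl⟩
      exact (ih a).2 (by lia)

theorem admitsUnboundedFixedPoints_of_chains {K : Set FinDigraph}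
    (χ : Language.graph.Formula (Fin 2)) (hK : ∀ n, ∃ G ∈ K, ∃ f : Fin (n + 1) → G.V,
      ∀ w b, FOSat G.graph χ ![w, f b] ↔ ∃ a, a.val + 1 = b.val ∧ w = f a) :
    AdmitsUnboundedFixedPoints K := by
  refine ⟨wellFoundedPart χ, fun ⟨j, hj⟩ => ?_⟩
  obtain ⟨G, hG, f, hf⟩ := hK j
  have mem_stage (i) := mem_wellFoundedPart_stage_iff_of_chain hf Fin.elim0 i (Fin.last j)
  have hlast : (fun _ => f (Fin.last j)) ∈ (wellFoundedPart χ).stage G.graph Fin.elim0 j := by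
    rw [hj G hG Fin.elim0]
    exact Set.mem_iUnion.2 ⟨j + 1, (mem_stage _).2 (Nat.lt_succ_self j)⟩
  exact (Nat.lt_irrefl j) ((mem_stage j).1 hlast)

/-! ### The construction -/

namespace Multigraph

/-- The nodes `0, …, n`, with three edges from each of them to its successor and two edges between
all other pairs, so that the nodes are distinguished from the edges in the subdivision. -/
def path (n : ℕ) : Multigraph where
  X := Fin (n + 1)
  mult a b := if a.val + 1 = b.val then 3 else 2

theorem path_mult_eq_three_iff {n : ℕ} {a b : Fin (n + 1)} :
    (path n).mult a b = 3 ↔ a.val + 1 = b.val := by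
  simp [path]

theorem two_le_path_mult {n : ℕ} (a b : Fin (n + 1)) : 2 ≤ (path n).mult a b := by
  grind [path]

theorem path_mult_lt_four {n : ℕ} (a b : Fin (n + 1)) : (path n).mult a b < 4 := by
  grind [path]

/-- The recording of the `i`-th formula uses multiplicities from `threshold F i` on: these exceed
the multiplicities of the path and those used by the previous recordings. -/
noncomputable def threshold (F : ℕ → InfinitaryFormula.{u}) (i : ℕ) : ℕ :=
  4 + ∑ j ∈ Finset.range i, ((F j).1 + Nat.card (Label (F j).1))

/-- The multigraph obtained from a path by recording the first `i` formulas. -/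
noncomputable def tower (F : ℕ → InfinitaryFormula.{u}) (n : ℕ) : ℕ → Multigraph
  | 0 => path n
  | i + 1 => (tower F n i).record ((tower F n i).trueProfiles (F i).2) (threshold F i)

variable (F : ℕ → InfinitaryFormula.{u}) (n : ℕ)

theorem threshold_succ (i : ℕ) :
    threshold F (i + 1) = threshold F i + ((F i).1 + Nat.card (Label (F i).1)) := by
  rw [threshold, Finset.sum_range_succ, ← add_assoc, threshold]

theorem threshold_mono : Monotone (threshold F) :=
  monotone_nat_of_le_succ fun i => (Nat.le_add_right _ _).trans (threshold_succ F i).ge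

theorem four_le_threshold (i : ℕ) : 4 ≤ threshold F i := Nat.le_add_right _ _

theorem tower_mult_lt (i : ℕ) (x y : (tower F n i).X) : (tower F n i).mult x y < threshold F i := by
  induction i with
  | zero => exact (path_mult_lt_four x y).trans_le (four_le_threshold F 0)
  | succ i ih => exact (record_mult_lt ih x y).trans_eq (threshold_succ F i).symm

theorem exists_extends_tower {i j : ℕ} (h : i ≤ j) :
    ∃ f : (tower F n i).X ↪ (tower F n j).X, Extends (threshold F i) f := by
  induction j, h using Nat.le_induction with
  | base => exact ⟨_, .refl _ _⟩
  | succ j hj ih =>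
    obtain ⟨f, hf⟩ := ih
    exact ⟨_, hf.trans (extends_toRecord.mono (Nat.le_add_right _ _)) (threshold_mono F hj)⟩

theorem exists_extends_path (i : ℕ) : ∃ f : (path n).X ↪ (tower F n i).X, Extends 4 f :=
  (exists_extends_tower F n i.zero_le).imp fun _ hf => hf.mono (four_le_threshold F 0)

theorem two_le_tower_mult (i : ℕ) (x y : (tower F n i).X) : 2 ≤ (tower F n i).mult x y := by
  obtain ⟨f, hf⟩ := exists_extends_path F n i
  by_contra! hlt
  obtain ⟨⟨a, rfl⟩, ⟨b, rfl⟩⟩ := hf.mem_range_of_mult_lt (hlt.trans (by decide))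
  rw [hf.mult_eq] at hlt
  exact hlt.not_ge (two_le_path_mult a b)

theorem sat_tower_iff_isRecorded {i : ℕ} (h : i < n) (v : Fin (F i).1 → (tower F n n).Point) :
    (F i).2.Sat (tower F n n).subdivision v ↔
      IsRecorded (tower F n n).subdivision (threshold F i) v := by
  obtain ⟨g, hg⟩ := exists_extends_tower F n (Nat.succ_le_of_lt h)
  rw [threshold_succ] at hg
  have hgeneric := isGeneric_toRecord.trans hg (le_add_left (Nat.le_add_right _ _))
  rw [← profile_mem_trueProfiles_iff hgeneric]
  exact (isRecorded_subdivision_iff hg ((by decide : 2 ≤ 4).trans (four_le_threshold F i))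
    (fun a => tower_mult_lt F n i a a) (two_le_tower_mult F n n)).symm

theorem exists_chain_tower (i : ℕ) : ∃ f : Fin (n + 1) → (tower F n i).Point, ∀ z b,
    HasExactPaths (tower F n i).subdivision 3 z (f b) ↔
      ∃ a, a.val + 1 = b.val ∧ z = f a := by
  obtain ⟨f, hf⟩ := exists_extends_path F n i
  refine ⟨fun a => .inl (f a), fun z b => ⟨fun h => ?_, ?_⟩⟩
  · obtain ⟨x, rfl⟩ := eq_inl_of_hasPaths (by decide) h.1
    rw [hasExactPaths_subdivision] at h
    obtain ⟨a, rfl⟩ := (hf.mem_range_of_mult_lt (h.trans_lt (by decide))).1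
    exact ⟨a, path_mult_eq_three_iff.1 ((hf.mult_eq a b).symm.trans h), rfl⟩
  · rintro ⟨a, hab, rfl⟩
    exact hasExactPaths_subdivision.2 ((hf.mult_eq a b).trans (path_mult_eq_three_iff.2 hab))

instance (i : ℕ) : Nonempty (tower F n i).X :=
  let ⟨f, _⟩ := exists_extends_path F n i
  ⟨f (0 : Fin (n + 1))⟩

/-- The subdivision of the path with `n + 1` nodes on which the first `n` formulas are recorded. -/
noncomputable def towerGraph : FinDigraph := (tower F n n).toFinDigraph

theorem admitsUnboundedFixedPoints_towerGraph :
    AdmitsUnboundedFixedPoints (isoClosure (Set.range (towerGraph F))) := by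
  obtain ⟨χ, hχ⟩ := FODefinable.hasExactPaths 3 (0 : Fin 2) 1
  refine admitsUnboundedFixedPoints_of_chains χ fun n => ?_
  obtain ⟨f, hf⟩ := exists_chain_tower F n n
  exact ⟨towerGraph F n, subset_isoClosure _ ⟨n, rfl⟩, f, fun w b => (hχ _ _ _).symm.trans (hf w b)⟩

end Multigraph

end McColm

theorem mainTheorem2 (L : Set McColm.InfinitaryFormula.{u}) (hL : L.Countable) :
    ∃ K : Set McColm.FinDigraph, McColm.IsoClosed K ∧ McColm.AdmitsUnboundedFixedPoints K ∧
      ∀ φ ∈ L, McColm.EquivFirstOrder K φ := by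
  have : Nonempty McColm.InfinitaryFormula.{u} := ⟨⟨0, .conj PEmpty.elim⟩⟩
  obtain ⟨F, hF⟩ := Set.countable_iff_exists_subset_range.1 hL
  refine ⟨McColm.isoClosure (Set.range (McColm.Multigraph.towerGraph F)),
    McColm.isoClosed_isoClosure _, McColm.Multigraph.admitsUnboundedFixedPoints_towerGraph F, ?_⟩
  intro φ hφ
  obtain ⟨i, rfl⟩ := hF hφ
  exact (F i).2.isoInvariant_sat.exists_formula_of_forall_gt (.isRecorded _) _ i
    fun n hn v => McColm.Multigraph.sat_tower_iff_isRecorded F n hn v
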